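/- Theorem (propagation of chaos for the Repeated Balls-into-Bins process). For $L\in\mathbb N$ and $\eta\in\mathbb Z_+^L$ let $w(\eta):=(\mathbf 1(\eta_1>0),\dots,\mathbf 1(\eta_L>0))$. The RBB process with $L$ bins is the Markov chain $(\eta^L(t))_{t\in\mathbb Z_+}$ on $\mathbb Z_+^L$ such that, given $\eta^L(t)=\eta$, one has $\eta^L(t+1)=\eta-w(\eta)+B(\eta)$, where $B(\eta)$ is an $L$-dimensional multinomial random vector with parameters $\sum_{j}\mathbf 1(\eta_j>0)$ (number of trials) and $(1/L,\dots,1/L)$. Given a probability measure $\mu$ on $\mathbb Z_+$, the nonlinear process started from $\mu$ is the $\mathbb Z_+$-valued process $(\eta(t))_{t\in\mathbb Z_+}$ with $\eta(0)\sim\mu$ and $$\eta(t+1)=\eta(t)-\mathbf 1(\eta(t)>0)+N_{t+1},\qquad t\ge 0,$$ where $N_{t+1}$ is independent of $(\eta(0),\dots,\eta(t))$ and is a Poisson random variable with expected value $\rho(t):=\mathbb P(\eta(t)>0)$ (the $0$ random variable if $\rho(t)=0$). Assume that for every $L$ the initial state $\eta^L(0)$ is finitely exchangeable (its law is invariant under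 all permutations of the $L$ components) and that, for some probability measure $\mu$ on $\mathbb Z_+$, $$\lim_{L\to+\infty}\mathbb P\big(\eta^L_1(0)=\xi_1,\dots,\eta^L_n(0)=\xi_n\big)=\prod_{k=1}^n\mu(\{\xi_k\})$$ for every $n\in\mathbb N$ and all $\xi_1,\dots,\xi_n\in\mathbb Z_+$. Then, for every $L$, the process $(\eta^L(t))_{t\in\mathbb Z_+}$ is finitely exchangeable: $\eta^L(t)$ is finitely exchangeable for each $t$, and moreover the joint law of the $L$ trajectories $(\eta^L_1(t))_{t\in\mathbb Z_+},\dots,(\eta^L_L(t))_{t\in\mathbb Z_+}$ is invariant under permutations of the bins. Furthermore, for every $T\in\mathbb Z_+$, every $n\in\mathbb N$ and all bounded functions $\Phi_{1,T},\dots,\Phi_{n,T}:\mathbb Z_+^{T+1}\to\mathbb C$, $$\lim_{L\to+\infty}\mathbb E\Big[\prod_{k=1}^n\Phi_{k,T}\big(\eta^L_k(0),\dots,\eta^L_k(T)\big)\Big]=\prod_{k=1}^n\mathbb E\big[\Phi_{k,T}(\eta(0),\dots,\eta(T))\big],$$ where $\eta$ is the nonlinear process started from $\mu$. -/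

import Mathlib

open MeasureTheory ProbabilityTheory Filter Topology
open scoped NNReal ENNReal

namespace RBB

/-- The vector `w(η) = (1(η₁ > 0), …, 1(η_L > 0))`. -/
def occupied {L : ℕ} (η : Fin L → ℕ) : Fin L → ℕ := fun i => if 0 < η i then 1 else 0

/-- The number `L w̄_L(η)` of non-empty bins, i.e. the number of balls reassigned in one step. -/
def numOccupied {L : ℕ} (η : Fin L → ℕ) : ℕ := ∑ i, occupied η i

/-- The transition matrix `P_L(η, ζ)` of the RBB chain: the probability that
`η - w(η) + B = ζ`, where `B` is multinomial with parameters `numOccupied η` and `(1/L, …, 1/L)`.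
The sum runs over all `σ : Fin L → ℕ` with `∑ i, σ i = numOccupied η`; the subtraction is
exact because `occupied η ≤ η`. -/
noncomputable def transition {L : ℕ} (η ζ : Fin L → ℕ) : ℝ :=
  (∑ σ ∈ Finset.univ.piAntidiag (numOccupied η),
      if η - occupied η + σ = ζ then (Nat.multinomial Finset.univ σ : ℝ) else 0) /
    (L : ℝ) ^ numOccupied η

/-- `X` is an RBB process with `L` bins: a Markov chain with transition matrix `transition`,
with an arbitrary initial law. -/
structure IsRBBProcess {Ω : Type*} [MeasurableSpace Ω] {L : ℕ}
    (X : ℕ → Ω → Fin L → ℕ) (P : Measure Ω) : Prop where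
  measurable : ∀ t, Measurable (X t)
  markov : ∀ (t : ℕ) (x : ℕ → Fin L → ℕ),
    P.real {ω | ∀ s ≤ t + 1, X s ω = x s} =
      P.real {ω | ∀ s ≤ t, X s ω = x s} * transition (x t) (x (t + 1))

/-- Finite exchangeability of a random vector `Y = (Y₁, …, Y_L)` with values in a measurable
space `S`: its law is invariant under all permutations of the components. -/
def FinitelyExchangeable {Ω S : Type*} [MeasurableSpace Ω] [MeasurableSpace S] {L : ℕ}
    (Y : Ω → Fin L → S) (P : Measure Ω) : Prop :=
  ∀ σ : Equiv.Perm (Fin L), P.map (fun ω i => Y ω (σ i)) = P.map Y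

/-- `η` is a nonlinear process with initial law `μ`:
`η(t+1) = η(t) - 1(η(t) > 0) + N_{t+1}`, where `N_{t+1}` (written `N t` below) is Poisson with
expected value `ρ(t) = Q(η(t) > 0)` and independent of the past `(η(0), …, η(t))`. -/
structure IsNonlinearProcess {Ω : Type*} [MeasurableSpace Ω]
    (η : ℕ → Ω → ℕ) (μ : Measure ℕ) (Q : Measure Ω) : Prop where
  measurable : ∀ t, Measurable (η t)
  initial : Q.map (η 0) = μ
  step : ∃ N : ℕ → Ω → ℕ, ∀ t,
    Measurable (N t) ∧
    Q.map (N t) = poissonMeasure (Q {ω | 0 < η t ω}).toNNReal ∧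
    IndepFun (fun ω (s : Fin (t + 1)) => η s ω) (N t) Q ∧
    ∀ᵐ ω ∂Q, η (t + 1) ω = η t ω - (if 0 < η t ω then 1 else 0) + N t ω

end RBB

namespace RBB

/-! The bins interact only through the number M of non-empty bins. Given the state at time t, the
balls received by the first n bins form a multinomial marginal, explicitly computable
(`sum_multinomial_marginal`). With B = ∑ b_k, the probability that they receive b differs from a
product of Poisson(r) masses by at most (B² + Bn + n²)/L + (B + n)|M/L - r|
(`abs_marginal_sub_poisson_le`).

It remains to know that M/L is close to r = ρ(t) in mean. Exchangeability bounds the second moment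
of M/L - r by 1/L plus the absolute correlation of two bins
(`FinitelyExchangeable.integral_mean_sq_le`), and chaos for two bins at time t makes this
correlation vanish (`ChaoticUpTo.tendsto_numOccupied`). Thus chaos of path probabilities up to time
t implies chaos up to t + 1 (`ChaoticUpTo.succ`). Path spaces over finite horizons are countable, so
convergence of point masses to a probability law gives convergence of integrals of bounded
functions.

Exchangeability at all times holds because the transition matrix commutes with relabelling the bins
(`transition_comp`), so every path probability is invariant. -/

/-- The law of `η - w(η) + B(η)`. -/
noncomputable def stepMeasure {L : ℕ} (η : Fin L → ℕ) : Measure (Fin L → ℕ) :=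
  ∑ σ ∈ Finset.univ.piAntidiag (numOccupied η),
    ENNReal.ofReal ((Nat.multinomial Finset.univ σ : ℝ) / (L : ℝ) ^ numOccupied η) •
      Measure.dirac (η - occupied η + σ)

open Classical in
lemma stepMeasure_real {L : ℕ} (η : Fin L → ℕ) (D : Set (Fin L → ℕ)) :
    (stepMeasure η).real D = (∑ σ ∈ Finset.univ.piAntidiag (numOccupied η),
      if η - occupied η + σ ∈ D then (Nat.multinomial Finset.univ σ : ℝ) else 0) /
    (L : ℝ) ^ numOccupied η := by
  rw [measureReal_def, stepMeasure, Measure.finsetSum_apply, ENNReal.toReal_sum, Finset.sum_div]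
  · refine Finset.sum_congr rfl fun σ _ => ?_
    rw [Measure.smul_apply, Measure.dirac_apply' _ (Set.to_countable D).measurableSet, smul_eq_mul,
      ENNReal.toReal_mul, ENNReal.toReal_ofReal (by positivity)]
    by_cases h : η - occupied η + σ ∈ D <;> simp [h]
  · intro σ _
    rw [Measure.smul_apply, Measure.dirac_apply' _ (Set.to_countable D).measurableSet, smul_eq_mul]
    by_cases h : η - occupied η + σ ∈ D <;> simp [h]

instance {L : ℕ} (η : Fin L → ℕ) : IsFiniteMeasure (stepMeasure η) := by
  unfold stepMeasure
  refine ⟨?_⟩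
  rw [Measure.finsetSum_apply]
  refine ENNReal.sum_lt_top.2 fun σ _ => ?_
  simp

lemma stepMeasure_real_singleton {L : ℕ} (η ζ : Fin L → ℕ) :
    (stepMeasure η).real {ζ} = transition η ζ := by
  rw [stepMeasure_real, transition]
  simp

lemma numOccupied_le {L : ℕ} (η : Fin L → ℕ) : numOccupied η ≤ L := by
  unfold numOccupied occupied
  calc _ ≤ ∑ i : Fin L, 1 := Finset.sum_le_sum fun i _ => by split_ifs <;> simp
    _ = L := by simp

lemma sum_multinomial (m M : ℕ) :
    ∑ σ ∈ (Finset.univ : Finset (Fin m)).piAntidiag M, Nat.multinomial Finset.univ σ = m ^ M := by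
  have := Finset.sum_pow_eq_sum_piAntidiag (R := ℕ) (Finset.univ : Finset (Fin m)) (fun _ => 1) M
  simpa using this.symm

lemma stepMeasure_real_le_one {L : ℕ} (η : Fin L → ℕ) (D : Set (Fin L → ℕ)) :
    (stepMeasure η).real D ≤ 1 := by
  classical
  rw [stepMeasure_real]
  refine div_le_one_of_le₀ ?_ (by positivity)
  calc _ ≤ ∑ σ ∈ (Finset.univ : Finset (Fin L)).piAntidiag (numOccupied η),
        (Nat.multinomial Finset.univ σ : ℝ) :=
        Finset.sum_le_sum fun σ _ => by split_ifs <;> simp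
    _ = _ := by exact_mod_cast sum_multinomial L (numOccupied η)

/-! ### Finite trajectories and the Markov property -/

/-- The trajectory up to time `t`. -/
def hist {Ω S : Type*} (X : ℕ → Ω → S) (t : ℕ) (ω : Ω) : Fin (t + 1) → S := fun s => X s ω

lemma hist_eq_iff {Ω S : Type*} (X : ℕ → Ω → S) (t : ℕ) (ω : Ω) (x : ℕ → S) :
    hist X t ω = (fun s : Fin (t + 1) => x s) ↔ ∀ s ≤ t, X s ω = x s := by
  constructor
  · intro h s hs
    exact congrFun h ⟨s, by omega⟩
  · intro h
    funext s
    exact h s (by omega)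

/-- The Markov property is phrased with paths indexed by all of ℕ, of which only finitely many times
matter; the values added after time t are arbitrary. -/
lemma exists_extension {S : Type*} {t : ℕ} (x : Fin (t + 1) → S) :
    ∃ y : ℕ → S, (fun s : Fin (t + 1) => y s) = x := by
  refine ⟨fun s => if h : s < t + 1 then x ⟨s, h⟩ else x 0, ?_⟩
  funext s
  exact dif_pos s.2

section Trajectories

variable {Ω : Type*} [MeasurableSpace Ω] {P : Measure Ω}

lemma measurable_hist {S : Type*} [MeasurableSpace S] {X : ℕ → Ω → S}
    (hX : ∀ t, Measurable (X t)) (t : ℕ) :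
    Measurable (hist X t) := measurable_pi_lambda _ fun s => hX s

/-- The form without conditioning spares a separate treatment of pasts of probability zero. Both
sides are finite measures on a countable space, so singletons suffice, where the claim is the
defining identity of the chain. -/
lemma IsRBBProcess.map_restrict [IsFiniteMeasure P] {L : ℕ} {X : ℕ → Ω → Fin L → ℕ}
    (hX : IsRBBProcess X P) (t : ℕ) (x : Fin (t + 1) → Fin L → ℕ) :
    (P.restrict (hist X t ⁻¹' {x})).map (X (t + 1)) =
      P (hist X t ⁻¹' {x}) • stepMeasure (x (Fin.last t)) := by
  refine Measure.ext_of_singleton fun y => ?_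
  have hfin : IsFiniteMeasure (P (hist X t ⁻¹' {x}) • stepMeasure (x (Fin.last t))) :=
    ⟨by simp [ENNReal.mul_lt_top]⟩
  rw [← measureReal_eq_measureReal_iff]
  rw [map_measureReal_apply (hX.measurable _) (measurableSet_singleton y),
    measureReal_restrict_apply (hX.measurable _ (measurableSet_singleton y)),
    measureReal_ennreal_smul_apply, stepMeasure_real_singleton]
  obtain ⟨x', rfl⟩ := exists_extension x
  -- The path follows the given past up to time t and then jumps to y.
  have := hX.markov t (fun s => if s ≤ t then x' s else y)
  have e1 : {ω | ∀ s ≤ t + 1, X s ω = if s ≤ t then x' s else y} =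
      X (t + 1) ⁻¹' {y} ∩ hist X t ⁻¹' {fun s : Fin (t + 1) => x' s} := by
    ext ω
    simp only [Set.mem_ofPred_eq, Set.mem_inter_iff, Set.mem_preimage, Set.mem_singleton_iff,
      hist_eq_iff]
    constructor
    · intro h
      exact ⟨by simpa using h (t + 1) le_rfl, fun s hs => by simpa [hs] using h s (by omega)⟩
    · rintro ⟨h1, h2⟩ s hs
      split_ifs with h
      · exact h2 s h
      · obtain rfl : s = t + 1 := by omega
        exact h1
  have e2 : {ω | ∀ s ≤ t, X s ω = if s ≤ t then x' s else y} =
      hist X t ⁻¹' {fun s : Fin (t + 1) => x' s} := by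
    ext ω
    simp only [Set.mem_ofPred_eq, Set.mem_preimage, Set.mem_singleton_iff, hist_eq_iff]
    exact forall₂_congr fun s hs => by simp [hs]
  rw [e1, e2] at this
  simpa [measureReal_def] using this

/-- The Markov property of the RBB process, for events of the past. -/
lemma IsRBBProcess.real_inter [IsFiniteMeasure P] {L : ℕ} {X : ℕ → Ω → Fin L → ℕ}
    (hX : IsRBBProcess X P) (t : ℕ) (A : Set (Fin (t + 1) → Fin L → ℕ)) (D : Set (Fin L → ℕ)) :
    P.real (hist X t ⁻¹' A ∩ X (t + 1) ⁻¹' D) =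
      ∫ ω in hist X t ⁻¹' A, (stepMeasure (X t ω)).real D ∂P := by
  have hmD : MeasurableSet D := (Set.to_countable D).measurableSet
  have hmA : MeasurableSet A := (Set.to_countable A).measurableSet
  have hH := measurable_hist hX.measurable t
  have hXD := hX.measurable (t + 1) hmD
  have hf : Measurable (fun x : Fin (t + 1) → Fin L → ℕ =>
      A.indicator (fun x => (stepMeasure (x (Fin.last t))).real D) x) := measurable_of_countable _
  have h1 : P.real (hist X t ⁻¹' A ∩ X (t + 1) ⁻¹' D) =
      ∫ x, A.indicator (fun _ => (1 : ℝ)) x ∂((P.restrict (X (t + 1) ⁻¹' D)).map (hist X t)) := by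
    rw [integral_indicator_const _ hmA, map_measureReal_apply hH hmA,
      measureReal_restrict_apply (hH hmA), smul_eq_mul, mul_one]
  have h2 : ∫ ω in hist X t ⁻¹' A, (stepMeasure (X t ω)).real D ∂P =
      ∫ x, A.indicator (fun x => (stepMeasure (x (Fin.last t))).real D) x ∂(P.map (hist X t)) := by
    rw [integral_map hH.aemeasurable hf.aestronglyMeasurable, ← integral_indicator (hH hmA)]
    rfl
  -- There are countably many pasts, so both integrals are sums over x, compared term by term
  -- through `map_restrict`.
  rw [h1, h2, integral_countable, integral_countable]
  · refine tsum_congr fun x => ?_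
    rw [map_measureReal_apply hH (measurableSet_singleton x),
      map_measureReal_apply hH (measurableSet_singleton x),
      measureReal_restrict_apply (hH (measurableSet_singleton x))]
    by_cases hx : x ∈ A
    · have := congrArg (fun ν : Measure (Fin L → ℕ) => ν.real D) (hX.map_restrict t x)
      rw [map_measureReal_apply (hX.measurable _) hmD, measureReal_restrict_apply hXD,
        measureReal_ennreal_smul_apply] at this
      simpa [hx, Set.inter_comm, measureReal_def] using this
    · simp [hx]
  · refine Integrable.of_bound hf.aestronglyMeasurable 1 (Eventually.of_forall fun x => ?_)
    by_cases hx : x ∈ A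
    · simpa [hx, abs_of_nonneg] using stepMeasure_real_le_one _ _
    · simp [hx]
  · exact (integrable_const _).indicator hmA

/-! ### Invariance under permutations of the bins -/

lemma occupied_comp {L : ℕ} (η : Fin L → ℕ) (σ : Equiv.Perm (Fin L)) :
    occupied (η ∘ σ) = occupied η ∘ σ := rfl

lemma numOccupied_comp {L : ℕ} (η : Fin L → ℕ) (σ : Equiv.Perm (Fin L)) :
    numOccupied (η ∘ σ) = numOccupied η := Equiv.sum_comp σ (occupied η)

/-- Relabelling the bins permutes the multinomial vectors, τ ↦ τ ∘ σ⁻¹, and preserves both their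
total and their coefficient. -/
lemma transition_comp {L : ℕ} (η ζ : Fin L → ℕ) (σ : Equiv.Perm (Fin L)) :
    transition (η ∘ σ) (ζ ∘ σ) = transition η ζ := by
  unfold transition
  rw [numOccupied_comp]
  congr 1
  refine Finset.sum_equiv (σ.arrowCongr (Equiv.refl ℕ)) (fun τ => ?_) fun τ _ => ?_
  · have : ∑ i, (σ.arrowCongr (Equiv.refl ℕ)) τ i = ∑ i, τ i := by
      simpa using Equiv.sum_comp σ.symm τ
    simp only [Finset.mem_piAntidiag, this, Finset.mem_univ, implies_true]
  · have h1 : (η ∘ σ - occupied (η ∘ σ) + τ = ζ ∘ σ) ↔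
        η - occupied η + (σ.arrowCongr (Equiv.refl ℕ)) τ = ζ := by
      rw [occupied_comp]
      constructor
      · intro h
        funext i
        simpa using congrFun h (σ.symm i)
      · intro h
        funext i
        simpa using congrFun h (σ i)
    have h2 : Nat.multinomial Finset.univ ((σ.arrowCongr (Equiv.refl ℕ)) τ) =
        Nat.multinomial Finset.univ τ := by
      unfold Nat.multinomial
      congr 1
      · congr 1
        simpa using Equiv.sum_comp σ.symm τ
      · simpa using Equiv.prod_comp σ.symm (fun i => (τ i).factorial)
    simp only [h1, h2]

/-- A path probability is the initial mass times a product of transitions; the former is invariant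
by hypothesis, the latter by `transition_comp`. -/
lemma IsRBBProcess.real_hist_comp [IsFiniteMeasure P] {L : ℕ} {X : ℕ → Ω → Fin L → ℕ}
    (hX : IsRBBProcess X P) (hexch : FinitelyExchangeable (X 0) P) (σ : Equiv.Perm (Fin L))
    (x : ℕ → Fin L → ℕ) (t : ℕ) :
    P.real {ω | ∀ s ≤ t, X s ω = x s ∘ σ} = P.real {ω | ∀ s ≤ t, X s ω = x s} := by
  induction t with
  | zero =>
    have hm : Measurable (fun ω i => X 0 ω (σ.symm i)) :=
      measurable_pi_lambda _ fun i => (measurable_pi_apply _).comp (hX.measurable 0)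
    -- X 0 equals x 0 ∘ σ exactly when its permutation by σ⁻¹ equals x 0, hence the inverse here.
    have := congrArg (fun ν : Measure (Fin L → ℕ) => ν.real {x 0}) (hexch σ.symm)
    rw [map_measureReal_apply hm (measurableSet_singleton _),
      map_measureReal_apply (hX.measurable 0) (measurableSet_singleton _)] at this
    convert this using 2
    · ext ω
      simp only [Nat.le_zero, forall_eq, Set.mem_ofPred_eq, Set.mem_preimage,
        Set.mem_singleton_iff]
      constructor
      · intro h
        funext i
        simp [h]
      · intro h
        rw [← h]
        funext i
        simp
    · ext ω
      simp
  | succ t ih =>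
    rw [hX.markov t x, hX.markov t (fun s => x s ∘ σ), ih, transition_comp]

lemma IsRBBProcess.map_hist_comp [IsFiniteMeasure P] {L : ℕ} {X : ℕ → Ω → Fin L → ℕ}
    (hX : IsRBBProcess X P) (hexch : FinitelyExchangeable (X 0) P) (σ : Equiv.Perm (Fin L))
    (t : ℕ) :
    P.map (hist (fun s ω i => X s ω (σ i)) t) = P.map (hist X t) := by
  have hm : ∀ s, Measurable (fun ω i => X s ω (σ i)) := fun s =>
    measurable_pi_lambda _ fun i => (measurable_pi_apply _).comp (hX.measurable s)
  refine Measure.ext_of_singleton fun x => ?_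
  rw [← measureReal_eq_measureReal_iff,
    map_measureReal_apply (measurable_hist hm t) (measurableSet_singleton _),
    map_measureReal_apply (measurable_hist hX.measurable t) (measurableSet_singleton _)]
  obtain ⟨x, rfl⟩ := exists_extension x
  have := hX.real_hist_comp hexch σ.symm x t
  convert this using 2
  · ext ω
    simp only [Set.mem_ofPred_eq, Set.mem_preimage, Set.mem_singleton_iff, hist_eq_iff]
    refine forall₂_congr fun s _ => ⟨fun h => ?_, fun h => ?_⟩
    · rw [← h]
      funext i
      simp
    · rw [h]
      funext i
      simp
  · ext ω
    simp only [Set.mem_ofPred_eq, Set.mem_preimage, Set.mem_singleton_iff, hist_eq_iff]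

/-- The law of an infinite trajectory is determined by its marginals on finite sets of times, each a
function of the history up to the largest of these times. -/
lemma IsRBBProcess.exchangeable_trajectory [IsFiniteMeasure P] {L : ℕ} {X : ℕ → Ω → Fin L → ℕ}
    (hX : IsRBBProcess X P) (hexch : FinitelyExchangeable (X 0) P) :
    FinitelyExchangeable (fun ω (i : Fin L) (t : ℕ) => X t ω i) P := by
  intro σ
  have hm : ∀ s, Measurable (fun ω i => X s ω (σ i)) := fun s =>
    measurable_pi_lambda _ fun i => (measurable_pi_apply _).comp (hX.measurable s)
  have hid : IdentDistrib (fun ω t i => X t ω (σ i)) (fun ω t => X t ω) P P := by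
    refine (identDistrib_iff_forall_finset_identDistrib (P := P) (X := fun t ω i => X t ω (σ i))
      (Y := X) (measurable_pi_lambda _ hm).aemeasurable
      (measurable_pi_lambda _ hX.measurable).aemeasurable).2 fun I => ?_
    have hI : ∀ s : I, (s : ℕ) < I.sup id + 1 :=
      fun s => Nat.lt_succ_of_le (Finset.le_sup (f := id) s.2)
    have h0 : IdentDistrib (hist (fun s ω i => X s ω (σ i)) (I.sup id)) (hist X (I.sup id)) P P :=
      ⟨(measurable_hist hm _).aemeasurable, (measurable_hist hX.measurable _).aemeasurable,
        hX.map_hist_comp hexch σ _⟩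
    exact h0.comp (u := fun y (s : I) => y ⟨s, hI s⟩)
      (measurable_pi_lambda _ fun s => measurable_pi_apply _)
  have := hid.comp (u := fun (y : ℕ → Fin L → ℕ) i t => y t i)
    (measurable_pi_lambda _ fun i => measurable_pi_lambda _ fun t =>
      (measurable_pi_apply i).comp (measurable_pi_apply t))
  exact this.map_eq

lemma FinitelyExchangeable.comp {S S' : Type*} [MeasurableSpace S] [MeasurableSpace S'] {L : ℕ}
    {Y : Ω → Fin L → S} (hY : FinitelyExchangeable Y P) (hm : Measurable Y) {f : S → S'}
    (hf : Measurable f) : FinitelyExchangeable (fun ω i => f (Y ω i)) P := by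
  intro σ
  have hu : Measurable (fun (y : Fin L → S) i => f (y i)) :=
    measurable_pi_lambda _ fun i => hf.comp (measurable_pi_apply i)
  have := congrArg (Measure.map (fun (y : Fin L → S) i => f (y i))) (hY σ)
  have hm' : Measurable (fun ω i => Y ω (σ i)) :=
    measurable_pi_lambda _ fun i => (measurable_pi_apply _).comp hm
  rwa [Measure.map_map hu hm',
    Measure.map_map hu hm] at this

lemma IsRBBProcess.exchangeable [IsFiniteMeasure P] {L : ℕ} {X : ℕ → Ω → Fin L → ℕ}
    (hX : IsRBBProcess X P) (hexch : FinitelyExchangeable (X 0) P) (t : ℕ) :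
    FinitelyExchangeable (X t) P :=
  (hX.exchangeable_trajectory hexch).comp
    (measurable_pi_lambda _ fun i => measurable_pi_lambda _ fun s =>
      (measurable_pi_apply i).comp (hX.measurable s))
    (f := fun y => y t) (measurable_pi_apply t)

/-! ### Multinomial marginals -/

/-- After multiplication by ∏ (τ k)!, both sides become the factorial of the total number of balls.
-/
lemma multinomial_append {n m : ℕ} (b : Fin n → ℕ) (τ : Fin m → ℕ) :
    (∏ k, (b k).factorial) * Nat.multinomial Finset.univ (Fin.append b τ) =
      (∑ k, b k + ∑ k, τ k).descFactorial (∑ k, b k) * Nat.multinomial Finset.univ τ := by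
  have h1 := Nat.multinomial_spec Finset.univ (Fin.append b τ)
  have h2 := Nat.multinomial_spec Finset.univ τ
  rw [Fin.prod_univ_add, Fin.sum_univ_add] at h1
  simp only [Fin.append_left, Fin.append_right] at h1
  have h3 := Nat.factorial_mul_descFactorial (Nat.le_add_right (∑ k, b k) (∑ k, τ k))
  rw [Nat.add_sub_cancel_left, ← h2, ← h1] at h3
  have h4 : 0 < ∏ k, (τ k).factorial := Finset.prod_pos fun k _ => Nat.factorial_pos _
  refine Nat.eq_of_mul_eq_mul_left h4 ?_
  linarith

lemma mem_piAntidiag_univ {n M : ℕ} (σ : Fin n → ℕ) :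
    σ ∈ (Finset.univ : Finset (Fin n)).piAntidiag M ↔ ∑ i, σ i = M := by
  simp [Finset.mem_piAntidiag]

/-- The marginal law of the first `n` components of a multinomial vector. -/
lemma sum_multinomial_marginal {n m : ℕ} (M : ℕ) (b : Fin n → ℕ) :
    ∑ σ ∈ (Finset.univ : Finset (Fin (n + m))).piAntidiag M,
      (if ∀ k, σ (Fin.castAdd m k) = b k then (Nat.multinomial Finset.univ σ : ℝ) else 0) =
    M.descFactorial (∑ k, b k) * (m : ℝ) ^ (M - ∑ k, b k) / ∏ k, ((b k).factorial : ℝ) := by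
  rw [← Finset.sum_filter]
  have hmem : ∀ σ : Fin (n + m) → ℕ, (∀ k, σ (Fin.castAdd m k) = b k) →
      Fin.append b (fun i => σ (Fin.natAdd n i)) = σ := by
    intro σ h
    funext i
    refine Fin.addCases (fun k => ?_) (fun k => ?_) i
    · simp [h]
    · simp
  have hsum : ∀ σ : Fin (n + m) → ℕ, (∀ k, σ (Fin.castAdd m k) = b k) →
      ∑ i, σ i = ∑ k, b k + ∑ i, σ (Fin.natAdd n i) := by
    intro σ h
    rw [Fin.sum_univ_add]
    simp [h]
  -- If b asks for more than M balls, the left sum has no nonzero term and the descending factorial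
  -- vanishes, so the truncated exponent is harmless.
  rcases lt_or_ge M (∑ k, b k) with hM | hM
  · rw [Nat.descFactorial_of_lt hM, Finset.sum_eq_zero]
    · simp
    · intro σ hσ
      simp only [Finset.mem_filter, mem_piAntidiag_univ] at hσ
      have := hsum σ hσ.2
      omega
  · have h1 : ∑ σ ∈ (Finset.univ : Finset (Fin (n + m))).piAntidiag M with
        (∀ k, σ (Fin.castAdd m k) = b k), (Nat.multinomial Finset.univ σ : ℝ) =
        ∑ τ ∈ (Finset.univ : Finset (Fin m)).piAntidiag (M - ∑ k, b k),
          (Nat.multinomial Finset.univ (Fin.append b τ) : ℝ) := by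
      refine Finset.sum_bij' (fun σ _ i => σ (Fin.natAdd n i)) (fun τ _ => Fin.append b τ)
        ?_ ?_ ?_ ?_ ?_
      · intro σ hσ
        simp only [Finset.mem_filter, mem_piAntidiag_univ] at hσ
        have := hsum σ hσ.2
        rw [mem_piAntidiag_univ]
        omega
      · intro τ hτ
        rw [mem_piAntidiag_univ] at hτ
        simp only [Finset.mem_filter, mem_piAntidiag_univ, implies_true, and_true, Fin.append_left]
        rw [Fin.sum_univ_add]
        simp only [Fin.append_left, Fin.append_right]
        omega
      · intro σ hσ
        exact hmem σ (Finset.mem_filter.1 hσ).2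
      · intro τ _
        funext i
        simp
      · intro σ hσ
        rw [hmem σ (Finset.mem_filter.1 hσ).2]
    have h2 : ∀ τ ∈ (Finset.univ : Finset (Fin m)).piAntidiag (M - ∑ k, b k),
        (Nat.multinomial Finset.univ (Fin.append b τ) : ℝ) =
          M.descFactorial (∑ k, b k) / (∏ k, ((b k).factorial : ℝ)) *
            (Nat.multinomial Finset.univ τ : ℝ) := by
      intro τ hτ
      have hτ' := (mem_piAntidiag_univ τ).1 hτ
      have h3 := multinomial_append b τ
      rw [hτ', Nat.add_sub_cancel' hM] at h3
      have h5 : (∏ k, ((b k).factorial : ℝ)) ≠ 0 :=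
        Finset.prod_ne_zero_iff.2 fun k _ => by positivity
      rw [div_mul_eq_mul_div, eq_div_iff h5, mul_comm]
      exact_mod_cast h3
    rw [h1, Finset.sum_congr rfl h2, ← Finset.mul_sum]
    have := sum_multinomial m (M - ∑ k, b k)
    rw [show ∑ τ ∈ (Finset.univ : Finset (Fin m)).piAntidiag (M - ∑ k, b k),
      (Nat.multinomial Finset.univ τ : ℝ) = (m : ℝ) ^ (M - ∑ k, b k) by exact_mod_cast this]
    ring

/-! ### Quantitative Poisson approximation -/

/-- Replace one factor at a time: the remaining factors lie in [0, 1] and do not enlarge the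
difference. -/
lemma abs_prod_range_sub_prod_range_le {a c : ℕ → ℝ} (ha : ∀ j, 0 ≤ a j ∧ a j ≤ 1)
    (hc : ∀ j, 0 ≤ c j ∧ c j ≤ 1) (B : ℕ) :
    |∏ j ∈ Finset.range B, a j - ∏ j ∈ Finset.range B, c j| ≤
      ∑ j ∈ Finset.range B, |a j - c j| := by
  induction B with
  | zero => simp
  | succ B ih =>
    rw [Finset.prod_range_succ, Finset.prod_range_succ, Finset.sum_range_succ]
    have h0 : |∏ j ∈ Finset.range B, c j| ≤ 1 := by
      rw [abs_of_nonneg (Finset.prod_nonneg fun j _ => (hc j).1)]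
      exact Finset.prod_le_one (fun j _ => (hc j).1) fun j _ => (hc j).2
    have h1 : |a B| ≤ 1 := by rw [abs_of_nonneg (ha B).1]; exact (ha B).2
    calc _ = |(∏ j ∈ Finset.range B, a j - ∏ j ∈ Finset.range B, c j) * a B +
          (∏ j ∈ Finset.range B, c j) * (a B - c B)| := by congr 1; ring
      _ ≤ |∏ j ∈ Finset.range B, a j - ∏ j ∈ Finset.range B, c j| * |a B| +
          |∏ j ∈ Finset.range B, c j| * |a B - c B| := by
        rw [← abs_mul, ← abs_mul]; exact abs_add_le _ _
      _ ≤ |∏ j ∈ Finset.range B, a j - ∏ j ∈ Finset.range B, c j| * 1 + 1 * |a B - c B| := by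
        gcongr
      _ ≤ _ := by linarith

lemma abs_mul_sub_mul_le {a b c d : ℝ} (hb : |b| ≤ 1) (hc : |c| ≤ 1) :
    |a * b - c * d| ≤ |a - c| + |b - d| := by
  calc _ = |(a - c) * b + c * (b - d)| := by congr 1; ring
    _ ≤ |a - c| * |b| + |c| * |b - d| := by rw [← abs_mul, ← abs_mul]; exact abs_add_le _ _
    _ ≤ |a - c| * 1 + 1 * |b - d| := by gcongr
    _ = _ := by ring

lemma abs_pow_sub_pow_le_of_mem_unit {x y : ℝ} (hx0 : 0 ≤ x) (hx1 : x ≤ 1) (hy0 : 0 ≤ y)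
    (hy1 : y ≤ 1) (B : ℕ) : |x ^ B - y ^ B| ≤ B * |x - y| := by
  simpa using abs_prod_range_sub_prod_range_le (a := fun _ => x) (c := fun _ => y)
    (fun _ => ⟨hx0, hx1⟩) (fun _ => ⟨hy0, hy1⟩) B

/-- For x ≤ y, factor out exp(-x) and apply 1 + u ≤ exp u at u = x - y. -/
lemma abs_exp_neg_sub_exp_neg_le {x y : ℝ} (hx : 0 ≤ x) (hy : 0 ≤ y) :
    |Real.exp (-x) - Real.exp (-y)| ≤ |x - y| := by
  wlog h : x ≤ y generalizing x y
  · rw [abs_sub_comm, abs_sub_comm x]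
    exact this hy hx (le_of_not_ge h)
  have h1 : Real.exp (-y) = Real.exp (-x) * Real.exp (x - y) := by
    rw [← Real.exp_add]; congr 1; ring
  have h2 : Real.exp (-x) ≤ 1 := Real.exp_le_one_iff.2 (by linarith)
  have h3 : Real.exp (x - y) ≤ 1 := Real.exp_le_one_iff.2 (by linarith)
  have h4 := Real.add_one_le_exp (x - y)
  rw [abs_of_nonpos (by linarith : x - y ≤ 0), h1,
    abs_of_nonneg (by nlinarith [Real.exp_pos (-x)])]
  nlinarith [Real.exp_pos (-x)]

/-- The base q = m/(n + m) is the probability that one ball misses the first n bins. Lowering the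
exponent from M to M - B costs Bn/l; replacing q = 1 - n/l by exp(-n/l) costs (n/l)² for each of the
M ≤ l factors. -/
lemma abs_pow_sub_exp_le {n m M : ℕ} (B : ℕ) (hM : M ≤ n + m) (hL : 0 < n + m) :
    |((m : ℝ) / (n + m : ℕ)) ^ (M - B) - Real.exp (-(n * (M / (n + m : ℕ))))| ≤
      (B * n + n ^ 2) / (n + m : ℕ) := by
  set l : ℝ := ((n + m : ℕ) : ℝ) with hl
  have hl0 : 0 < l := by rw [hl]; exact_mod_cast hL
  have hlnm : l = n + m := by simp [hl]
  set q : ℝ := m / l with hq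
  have hq0 : 0 ≤ q := by positivity
  have hqn : q = 1 - n / l := by rw [hq]; field_simp; linarith
  have hq1 : q ≤ 1 := by rw [hqn]; linarith [show (0 : ℝ) ≤ n / l by positivity]
  have hMl : (M : ℝ) ≤ l := by rw [hl]; exact_mod_cast hM
  have h1 : |q ^ (M - B) - q ^ M| ≤ B * (n / l) := by
    -- Because subtraction is truncated, the exponents differ by k = min(M, B).
    obtain ⟨k, hk, hkB⟩ : ∃ k, M = (M - B) + k ∧ k ≤ B := ⟨M - (M - B), by omega, by omega⟩
    have e : q ^ (M - B) - q ^ M = q ^ (M - B) * (1 ^ k - q ^ k) := by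
      conv_lhs => rw [hk, pow_add]
      rw [← hk]; ring
    rw [e, abs_mul]
    have h2 := abs_pow_sub_pow_le_of_mem_unit zero_le_one le_rfl hq0 hq1 k
    have h3 : |1 - q| = n / l := by rw [hqn, abs_of_nonneg] <;> ring_nf; positivity
    rw [h3] at h2
    have h4 : |q ^ (M - B)| ≤ 1 := by
      rw [abs_of_nonneg (by positivity)]; exact pow_le_one₀ hq0 hq1
    have h5 : (k : ℝ) ≤ B := by exact_mod_cast hkB
    calc _ ≤ 1 * (k * (n / l)) := by gcongr
      _ ≤ 1 * (B * (n / l)) := by gcongr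
      _ = _ := one_mul _
  have h2 : |q ^ M - Real.exp (-(n * (M / l)))| ≤ n ^ 2 / l := by
    have e : Real.exp (-(n * (M / l))) = Real.exp (-(n / l)) ^ M := by
      rw [← Real.exp_nat_mul]; congr 1; ring
    rw [e]
    have h3 := abs_pow_sub_pow_le_of_mem_unit hq0 hq1 (Real.exp_pos (-(n / l))).le
      (Real.exp_le_one_iff.2 (neg_nonpos.2 (by positivity))) M
    have hn1 : n / l ≤ 1 := by
      rw [div_le_one hl0, hlnm]; linarith [show (0 : ℝ) ≤ m by positivity]
    have h4 : |q - Real.exp (-(n / l))| ≤ (n / l) ^ 2 := by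
      have := Real.abs_exp_sub_one_sub_id_le (x := -(n / l))
        (by rw [abs_neg, abs_of_nonneg (by positivity)]; exact hn1)
      rw [abs_sub_comm, hqn]
      calc _ = |Real.exp (-(n / l)) - 1 - -(n / l)| := by congr 1; ring
        _ ≤ _ := by simpa using this
    calc _ ≤ (M : ℝ) * |q - Real.exp (-(n / l))| := h3
      _ ≤ l * (n / l) ^ 2 := by gcongr
      _ = _ := by field_simp
  calc _ ≤ |q ^ (M - B) - q ^ M| + |q ^ M - Real.exp (-(n * (M / l)))| := abs_sub_le _ _ _
    _ ≤ B * (n / l) + n ^ 2 / l := add_le_add h1 h2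
    _ = _ := by ring

/-- Each of the B factors (M - j)/l is within j/l ≤ B/l of M/l, even when M - j is truncated to
zero. -/
lemma abs_descFactorial_div_sub_le {M l : ℕ} (B : ℕ) (hM : M ≤ l) (hl : 0 < l) :
    |(M.descFactorial B : ℝ) / (l : ℝ) ^ B - ((M : ℝ) / l) ^ B| ≤ (B : ℝ) ^ 2 / l := by
  have hl0 : (0 : ℝ) < l := by exact_mod_cast hl
  have e1 : (M.descFactorial B : ℝ) / (l : ℝ) ^ B =
      ∏ j ∈ Finset.range B, (((M - j : ℕ) : ℝ) / l) := by
    rw [Nat.descFactorial_eq_prod_range, Finset.prod_div_distrib]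
    simp
  have e2 : ((M : ℝ) / l) ^ B = ∏ j ∈ Finset.range B, ((M : ℝ) / l) := by
    rw [Finset.prod_const, Finset.card_range]
  rw [e1, e2]
  have hle : ∀ k : ℕ, k ≤ l → 0 ≤ (k : ℝ) / l ∧ (k : ℝ) / l ≤ 1 := fun k hk =>
    ⟨by positivity, by rw [div_le_one hl0]; exact_mod_cast hk⟩
  refine (abs_prod_range_sub_prod_range_le (fun j => hle _ (by omega)) (fun j => hle _ hM)
    B).trans ?_
  calc _ ≤ ∑ j ∈ Finset.range B, (B : ℝ) / l := by
        refine Finset.sum_le_sum fun j hj => ?_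
        rw [← sub_div, abs_div, abs_of_pos hl0]
        gcongr
        have h1 : (M : ℝ) ≤ ((M - j : ℕ) : ℝ) + j := by exact_mod_cast (by omega : M ≤ M - j + j)
        have h2 : ((M - j : ℕ) : ℝ) ≤ M := by exact_mod_cast Nat.sub_le M j
        have h3 : (j : ℝ) ≤ B := by exact_mod_cast (Finset.mem_range.1 hj).le
        rw [abs_le]
        constructor <;> linarith [show (0 : ℝ) ≤ j by positivity]
    _ = _ := by simp; ring

/-- Quantitative Poisson approximation of the first `n` components of a multinomial vector. -/
lemma abs_marginal_sub_poisson_le {n m M : ℕ} (b : Fin n → ℕ) (hM : M ≤ n + m) (hL : 0 < n + m)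
    {r : ℝ} (hr0 : 0 ≤ r) (hr1 : r ≤ 1) :
    |M.descFactorial (∑ k, b k) * (m : ℝ) ^ (M - ∑ k, b k) / (∏ k, ((b k).factorial : ℝ)) /
        ((n + m : ℕ) : ℝ) ^ M - ∏ k, (Real.exp (-r) * r ^ b k / (b k).factorial)| ≤
      ((∑ k, b k : ℕ) ^ 2 + (∑ k, b k : ℕ) * n + n ^ 2) / (n + m : ℕ) +
        ((∑ k, b k : ℕ) + n) * |(M : ℝ) / (n + m : ℕ) - r| := by
  set B := ∑ k, b k with hB
  have e2 : ∏ k, (Real.exp (-r) * r ^ b k / (b k).factorial) =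
      r ^ B * Real.exp (-(n * r)) / ∏ k, ((b k).factorial : ℝ) := by
    rw [Finset.prod_div_distrib, Finset.prod_mul_distrib, Finset.prod_pow_eq_pow_sum,
      Finset.prod_const, Finset.card_univ, Fintype.card_fin, ← Real.exp_nat_mul, mul_comm]
    congr 3
    ring
  have hlL : (0 : ℝ) < (n + m : ℕ) := by exact_mod_cast hL
  have e1 : M.descFactorial B * (m : ℝ) ^ (M - B) / (∏ k, ((b k).factorial : ℝ)) /
      ((n + m : ℕ) : ℝ) ^ M = (M.descFactorial B : ℝ) / ((n + m : ℕ) : ℝ) ^ B *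
        ((m : ℝ) / (n + m : ℕ)) ^ (M - B) / ∏ k, ((b k).factorial : ℝ) := by
    rcases lt_or_ge M B with h | h
    · simp [Nat.descFactorial_of_lt h]
    · obtain ⟨c, rfl⟩ := Nat.exists_eq_add_of_le h
      rw [Nat.add_sub_cancel_left, pow_add, div_pow]
      ring
  rw [e1, e2, ← sub_div, abs_div]
  have hfac : 1 ≤ |∏ k, ((b k).factorial : ℝ)| := by
    refine le_trans ?_ (le_abs_self _)
    exact_mod_cast Finset.one_le_prod' fun k _ => Nat.succ_le_of_lt (Nat.factorial_pos (b k))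
  -- The common denominator ∏ (b k)! is at least 1 and can be dropped.
  refine (div_le_self (abs_nonneg _) hfac).trans ?_
  set l : ℝ := ((n + m : ℕ) : ℝ) with hl
  set x : ℝ := (M : ℝ) / l with hx
  have hx0 : 0 ≤ x := by positivity
  have hx1 : x ≤ 1 := by rw [hx, div_le_one hlL, hl]; exact_mod_cast hM
  have hq : |((m : ℝ) / l) ^ (M - B)| ≤ 1 := by
    rw [abs_of_nonneg (by positivity)]
    refine pow_le_one₀ (by positivity) ?_
    rw [div_le_one hlL, hl]
    exact_mod_cast Nat.le_add_left m n
  have hxB : |x ^ B| ≤ 1 := by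
    rw [abs_of_nonneg (by positivity)]; exact pow_le_one₀ hx0 hx1
  have hrB : |r ^ B| ≤ 1 := by
    rw [abs_of_nonneg (by positivity)]; exact pow_le_one₀ hr0 hr1
  have hex : |Real.exp (-(n * x))| ≤ 1 := by
    rw [Real.abs_exp]
    exact Real.exp_le_one_iff.2 (neg_nonpos.2 (by positivity))
  have h1 := abs_mul_sub_mul_le (a := (M.descFactorial B : ℝ) / l ^ B)
    (d := Real.exp (-(n * x))) hq hxB
  have h2 := abs_mul_sub_mul_le (a := x ^ B) (d := Real.exp (-(n * r))) hex hrB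
  have h3 := abs_descFactorial_div_sub_le B hM hL
  have h4 := abs_pow_sub_exp_le B hM hL
  have h5 := abs_pow_sub_pow_le_of_mem_unit hx0 hx1 hr0 hr1 B
  have h6 := abs_exp_neg_sub_exp_neg_le (x := n * x) (y := n * r) (by positivity) (by positivity)
  rw [← mul_sub, abs_mul, Nat.abs_cast] at h6
  -- The intermediate term is the Poisson expression with the actual fraction x = M/l as parameter;
  -- the second half moves x to r.
  calc _ ≤ _ := abs_sub_le _ (x ^ B * Real.exp (-(n * x))) _
    _ ≤ ((B : ℝ) ^ 2 / l + (B * n + n ^ 2) / l) + (B * |x - r| + n * |x - r|) := by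
      refine add_le_add (h1.trans (add_le_add h3 h4)) (h2.trans (add_le_add h5 h6))
    _ = _ := by ring

/-! ### Convergence of integrals, and second moments under exchangeability -/

/-- On a countable space, pointwise convergence of probability mass functions to a probability mass
function implies convergence of the integrals of bounded functions. -/
lemma tendsto_integral_of_tendsto_real_singleton {S : Type*} [MeasurableSpace S] [Countable S]
    [MeasurableSingletonClass S] {ν : ℕ → Measure S} [∀ m, IsProbabilityMeasure (ν m)]
    {ν' : Measure S} [IsProbabilityMeasure ν']
    (h : ∀ x, Tendsto (fun m => (ν m).real {x}) atTop (𝓝 (ν'.real {x})))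
    {f : S → ℂ} {C : ℝ} (hf : ∀ x, ‖f x‖ ≤ C) :
    Tendsto (fun m => ∫ x, f x ∂(ν m)) atTop (𝓝 (∫ x, f x ∂ν')) := by
  let _ : TopologicalSpace S := ⊥
  have _ : DiscreteTopology S := ⟨rfl⟩
  let N : ℕ → ProbabilityMeasure S := fun m => ⟨ν m, inferInstance⟩
  let N' : ProbabilityMeasure S := ⟨ν', inferInstance⟩
  -- In the discrete topology the empty set and the singletons form a convergence-determining
  -- π-system: every open set is a countable union of them.
  have hpi : IsPiSystem ({s : Set S | s.Subsingleton}) := by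
    intro s hs t _ _
    exact hs.anti Set.inter_subset_left
  have hN : Tendsto N atTop (𝓝 N') := by
    refine hpi.tendsto_probabilityMeasure_of_tendsto_of_mem
      (fun s _ => (Set.to_countable s).measurableSet) ?_ ?_
    · intro u _ x hx
      exact ⟨{x}, Set.subsingleton_singleton, by simp, by simpa using hx⟩
    · intro s hs
      rcases hs.eq_empty_or_singleton with rfl | ⟨x, rfl⟩
      · simp
      · rw [← NNReal.tendsto_coe]
        exact h x
  rw [ProbabilityMeasure.tendsto_iff_forall_integral_rclike_tendsto ℂ] at hN
  exact hN (BoundedContinuousFunction.ofNormedAddCommGroupDiscrete f C hf)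

/-- Double transitivity of the symmetric group, which makes all off-diagonal correlations of an
exchangeable vector equal. The first swap sends b to the preimage of j under the swap of a and i. -/
lemma exists_perm_apply_eq {α : Type*} [DecidableEq α] {a b i j : α} (hab : a ≠ b) (hij : i ≠ j) :
    ∃ σ : Equiv.Perm α, σ a = i ∧ σ b = j := by
  have h1 : Equiv.swap a i j ≠ a := by
    intro h
    have := congrArg (Equiv.swap a i) h
    rw [Equiv.swap_apply_self, Equiv.swap_apply_left] at this
    exact hij this.symm
  refine ⟨Equiv.swap a i * Equiv.swap b (Equiv.swap a i j), ?_, ?_⟩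
  · rw [Equiv.Perm.mul_apply, Equiv.swap_apply_of_ne_of_ne hab h1.symm, Equiv.swap_apply_left]
  · rw [Equiv.Perm.mul_apply, Equiv.swap_apply_left, Equiv.swap_apply_self]

/-- The second moment of the empirical mean of an exchangeable vector is controlled by the
correlation of two components. -/
lemma FinitelyExchangeable.integral_mean_sq_le [IsProbabilityMeasure P] {L : ℕ}
    {Y : Ω → Fin L → ℕ} (hY : FinitelyExchangeable Y P) (hm : Measurable Y) {g : ℕ → ℝ}
    (hg : ∀ x, |g x| ≤ 1) {a b : Fin L} (hab : a ≠ b) :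
    ∫ ω, ((∑ i, g (Y ω i)) / L) ^ 2 ∂P ≤ 1 / L + |∫ ω, g (Y ω a) * g (Y ω b) ∂P| := by
  have hL : (0 : ℝ) < L := by exact_mod_cast a.pos
  have hgm : ∀ i, Measurable fun ω => g (Y ω i) := fun i =>
    (measurable_of_countable g).comp ((measurable_pi_apply i).comp hm)
  have hle : ∀ i j ω, |g (Y ω i) * g (Y ω j)| ≤ 1 := fun i j ω => by
    rw [abs_mul]
    exact mul_le_one₀ (hg _) (abs_nonneg _) (hg _)
  have hint : ∀ i j, Integrable (fun ω => g (Y ω i) * g (Y ω j)) P := fun i j =>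
    Integrable.of_bound ((hgm i).mul (hgm j)).aestronglyMeasurable 1
      (Eventually.of_forall (hle i j))
  set c := ∫ ω, g (Y ω a) * g (Y ω b) ∂P with hc
  have hij : ∀ i j, i ≠ j → ∫ ω, g (Y ω i) * g (Y ω j) ∂P = c := by
    intro i j hne
    obtain ⟨σ, rfl, rfl⟩ := exists_perm_apply_eq hab hne
    have hmσ : Measurable (fun ω i => Y ω (σ i)) :=
      measurable_pi_lambda _ fun i => (measurable_pi_apply _).comp hm
    have hF : Measurable (fun y : Fin L → ℕ => g (y a) * g (y b)) := measurable_of_countable _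
    have h1 := integral_map hmσ.aemeasurable (hF.aestronglyMeasurable (μ := P.map _))
    have h2 := integral_map hm.aemeasurable (hF.aestronglyMeasurable (μ := P.map _))
    rw [hY σ] at h1
    exact h1.symm.trans h2
  -- The L diagonal terms, each at most 1, produce the 1/L after division by L².
  have hb : ∀ i j, ∫ ω, g (Y ω i) * g (Y ω j) ∂P ≤ (if i = j then 1 else 0) + |c| := by
    intro i j
    split_ifs with h
    · have : ∫ ω, g (Y ω i) * g (Y ω j) ∂P ≤ ∫ _, (1 : ℝ) ∂P :=
        integral_mono (hint i j) (integrable_const _) fun ω => (le_abs_self _).trans (hle i j ω)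
      rw [integral_const, probReal_univ, smul_eq_mul, mul_one] at this
      linarith [abs_nonneg c]
    · rw [hij i j h, zero_add]
      exact le_abs_self c
  have e : ∀ ω, ((∑ i, g (Y ω i)) / L) ^ 2 = (∑ i, ∑ j, g (Y ω i) * g (Y ω j)) / (L : ℝ) ^ 2 := by
    intro ω
    rw [div_pow, sq (∑ i, g (Y ω i)), Finset.sum_mul_sum]
  simp_rw [e]
  rw [integral_div, integral_finsetSum _ fun i _ => integrable_finsetSum _ fun j _ => hint i j]
  simp_rw [integral_finsetSum _ fun j _ => hint _ j]
  rw [div_le_iff₀ (by positivity)]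
  calc _ ≤ ∑ i : Fin L, ∑ j : Fin L, ((if i = j then 1 else 0) + |c|) :=
        Finset.sum_le_sum fun i _ => Finset.sum_le_sum fun j _ => hb i j
    _ = L + L ^ 2 * |c| := by
      simp [Finset.sum_add_distrib]; ring
    _ = _ := by field_simp

lemma integral_abs_le_sqrt [IsProbabilityMeasure P] {f : Ω → ℝ} (hf : Measurable f) {C : ℝ}
    (hC : ∀ ω, |f ω| ≤ C) : ∫ ω, |f ω| ∂P ≤ √(∫ ω, f ω ^ 2 ∂P) := by
  refine Real.le_sqrt_of_sq_le ?_
  have hmem : MemLp (fun ω => |f ω|) 2 P :=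
    MemLp.of_bound hf.abs.aestronglyMeasurable C (Eventually.of_forall fun ω => by simpa using hC ω)
  -- Nonnegativity of the variance of |f| is the inequality (E|f|)² ≤ E f².
  have := variance_nonneg (fun ω => |f ω|) P
  rw [variance_eq_sub hmem] at this
  simpa using this

/-! ### One step of the nonlinear process -/

/-- Once the past is fixed, reaching y (t + 1) means, up to a null set, that N t = b; independence
then splits off the Poisson mass. -/
lemma IsNonlinearProcess.real_succ {Q : Measure Ω} [IsProbabilityMeasure Q] {η : ℕ → Ω → ℕ}
    {μ : Measure ℕ} (hη : IsNonlinearProcess η μ Q) (t : ℕ) (y : ℕ → ℕ) (b : ℕ)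
    (hb : y (t + 1) = y t - (if 0 < y t then 1 else 0) + b) :
    Q.real {ω | ∀ s ≤ t + 1, η s ω = y s} = Q.real {ω | ∀ s ≤ t, η s ω = y s} *
      (Real.exp (-Q.real {ω | 0 < η t ω}) * Q.real {ω | 0 < η t ω} ^ b / b.factorial) := by
  obtain ⟨N, hN⟩ := hη.step
  obtain ⟨hmN, hmap, hind, hae⟩ := hN t
  have e : ({ω | ∀ s ≤ t + 1, η s ω = y s} : Set Ω) =ᵐ[Q]
      (hist η t ⁻¹' {fun s : Fin (t + 1) => y s} ∩ N t ⁻¹' {b} : Set Ω) := by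
    filter_upwards [hae] with ω hω
    refine propext ?_
    change (∀ s ≤ t + 1, η s ω = y s) ↔ hist η t ω = _ ∧ N t ω = b
    rw [hist_eq_iff]
    constructor
    · intro h
      refine ⟨fun s hs => h s (by omega), ?_⟩
      rw [h (t + 1) le_rfl, h t (by omega), hb] at hω
      omega
    · rintro ⟨h, h'⟩ s hs
      rcases Nat.lt_or_eq_of_le hs with hs | rfl
      · exact h s (by omega)
      · rw [hω, h t le_rfl, h', hb]
  have hi := hind.measure_inter_preimage_eq_mul {fun s : Fin (t + 1) => y s} {b}
    (measurableSet_singleton _) (measurableSet_singleton _)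
  have hp : Q.real (N t ⁻¹' {b}) =
      Real.exp (-Q.real {ω | 0 < η t ω}) * Q.real {ω | 0 < η t ω} ^ b / b.factorial := by
    rw [← map_measureReal_apply hmN (measurableSet_singleton b), hmap,
      poissonMeasure_real_singleton]
    rfl
  have e2 : {ω | ∀ s ≤ t, η s ω = y s} = hist η t ⁻¹' {fun s : Fin (t + 1) => y s} := by
    ext ω
    exact (hist_eq_iff η t ω y).symm
  rw [measureReal_congr e, e2, ← hp, measureReal_def]
  exact (congrArg ENNReal.toReal hi).trans ENNReal.toReal_mul

lemma IsNonlinearProcess.real_succ_eq_zero {Q : Measure Ω} {η : ℕ → Ω → ℕ}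
    {μ : Measure ℕ} (hη : IsNonlinearProcess η μ Q) (t : ℕ) (y : ℕ → ℕ)
    (hb : y (t + 1) < y t - (if 0 < y t then 1 else 0)) :
    Q.real {ω | ∀ s ≤ t + 1, η s ω = y s} = 0 := by
  obtain ⟨N, hN⟩ := hη.step
  obtain ⟨-, -, -, hae⟩ := hN t
  have : Q {ω | ∀ s ≤ t + 1, η s ω = y s} = 0 := by
    refine measure_eq_zero_iff_ae_notMem.2 ?_
    filter_upwards [hae] with ω hω h
    rw [h (t + 1) le_rfl, h t (by omega)] at hω
    omega
  simp [measureReal_def, this]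

end Trajectories

/-! ### Propagation of chaos -/

lemma tendsto_of_tendsto_add_left {W : ℕ → ℝ} {l : Filter ℝ} (k : ℕ)
    (h : Tendsto (fun m => W (k + m)) atTop l) : Tendsto W atTop l :=
  (tendsto_add_atTop_iff_nat k).1 (by simpa only [add_comm k] using h)

section Chaos

variable {Ω : ℕ → Type*} [∀ L, MeasurableSpace (Ω L)] {P : ∀ L, Measure (Ω L)}
  [∀ L, IsProbabilityMeasure (P L)] {X : ∀ L, ℕ → Ω L → Fin L → ℕ}
  {Ω' : Type*} [MeasurableSpace Ω'] {Q : Measure Ω'} {η : ℕ → Ω' → ℕ}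

/-- Any fixed number of bins follows asymptotically, up to time `t`, independent copies of `η`. -/
def ChaoticUpTo (P : ∀ L, Measure (Ω L)) (X : ∀ L, ℕ → Ω L → Fin L → ℕ) (Q : Measure Ω')
    (η : ℕ → Ω' → ℕ) (t : ℕ) : Prop :=
  ∀ (n : ℕ) (ξ : Fin n → ℕ → ℕ), Tendsto
    (fun m => (P (n + m)).real {ω | ∀ k, ∀ s ≤ t, X (n + m) s ω (Fin.castAdd m k) = ξ k s}) atTop
    (𝓝 (∏ k, Q.real {ω | ∀ s ≤ t, η s ω = ξ k s}))

/-- Chaos says that the point masses of the joint law of n trajectories converge to those of a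
product measure, under which the integral of the product factorizes. -/
lemma ChaoticUpTo.tendsto_integral [IsProbabilityMeasure Q] {T : ℕ}
    (h : ChaoticUpTo P X Q η T) (hX : ∀ L t, Measurable (X L t)) (hη : ∀ t, Measurable (η t))
    (n : ℕ) (Φ : Fin n → (Fin (T + 1) → ℕ) → ℂ) (hΦ : ∀ k, ∃ C : ℝ, ∀ x, ‖Φ k x‖ ≤ C) :
    Tendsto (fun m : ℕ =>
        ∫ ω, ∏ k : Fin n,
          Φ k (fun s : Fin (T + 1) => X (n + m) s ω (Fin.castAdd m k)) ∂(P (n + m)))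
      atTop (𝓝 (∏ k, ∫ ω, Φ k (fun s : Fin (T + 1) => η s ω) ∂Q)) := by
  choose C hC using hΦ
  have hH := measurable_hist hη T
  have hY : ∀ m, Measurable fun (ω : Ω (n + m)) (k : Fin n) (s : Fin (T + 1)) =>
      X (n + m) s ω (Fin.castAdd m k) := fun m =>
    measurable_pi_lambda _ fun k => measurable_pi_lambda _ fun s =>
      (measurable_pi_apply _).comp (hX (n + m) s)
  have hF : Measurable fun x : Fin n → Fin (T + 1) → ℕ => ∏ k, Φ k (x k) :=
    measurable_of_countable _
  have _ := fun m => Measure.isProbabilityMeasure_map (μ := P (n + m)) (hY m).aemeasurable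
  have _ := Measure.isProbabilityMeasure_map (μ := Q) hH.aemeasurable
  have key := tendsto_integral_of_tendsto_real_singleton
    (ν := fun m => (P (n + m)).map fun ω (k : Fin n) (s : Fin (T + 1)) =>
      X (n + m) s ω (Fin.castAdd m k))
    (ν' := Measure.pi fun _ : Fin n => Q.map (hist η T)) (f := fun x => ∏ k, Φ k (x k))
    (C := ∏ k, C k) ?_ ?_
  · rw [integral_fintype_prod_eq_prod] at key
    convert key using 2 with m
    · rw [integral_map (hY m).aemeasurable hF.aestronglyMeasurable]
    · refine Finset.prod_congr rfl fun k _ => ?_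
      rw [integral_map hH.aemeasurable (measurable_of_countable _).aestronglyMeasurable]
      rfl
  · intro x
    choose y hy using fun k => exists_extension (x k)
    obtain rfl : (fun k (s : Fin (T + 1)) => y k s) = x := funext hy
    convert h n y using 2 with m
    · rw [map_measureReal_apply (hY m) (measurableSet_singleton _)]
      congr 1
      ext ω
      simp only [Set.mem_preimage, Set.mem_singleton_iff, Set.mem_ofPred_eq, funext_iff]
      exact forall_congr' fun k =>
        ⟨fun h s hs => h ⟨s, by omega⟩, fun h s => h s (by omega)⟩
    · rw [measureReal_def, Measure.pi_singleton, ENNReal.toReal_prod]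
      refine Finset.prod_congr rfl fun k _ => ?_
      rw [← measureReal_def, map_measureReal_apply hH (measurableSet_singleton _)]
      congr 1
      ext ω
      exact hist_eq_iff η T ω (y k)
  · intro x
    rw [norm_prod]
    exact Finset.prod_le_prod (fun _ _ => norm_nonneg _) fun k _ => hC k _

/-- Law of large numbers for the fraction of non-empty bins. -/
lemma ChaoticUpTo.tendsto_numOccupied [IsProbabilityMeasure Q] {t : ℕ}
    (h : ChaoticUpTo P X Q η t) (hX : ∀ L t, Measurable (X L t)) (hη : ∀ t, Measurable (η t))
    (hexch : ∀ L, FinitelyExchangeable (X L t) (P L)) :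
    Tendsto (fun L : ℕ => ∫ ω, |(numOccupied (X L t ω) : ℝ) / L - Q.real {ω | 0 < η t ω}| ∂(P L))
      atTop (𝓝 0) := by
  set r := Q.real {ω | 0 < η t ω} with hr
  have hr0 : 0 ≤ r := measureReal_nonneg
  have hr1 : r ≤ 1 := measureReal_le_one
  let g : ℕ → ℝ := fun x => (if 0 < x then 1 else 0) - r
  have hg : ∀ x, |g x| ≤ 1 := fun x => by
    simp only [g]
    split_ifs <;> rw [abs_le] <;> constructor <;> linarith
  have hzero : ∫ ω, (g (η t ω) : ℂ) ∂Q = 0 := by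
    have hm : MeasurableSet {ω | 0 < η t ω} := measurableSet_lt measurable_const (hη t)
    have e : ∀ ω, g (η t ω) = {ω | 0 < η t ω}.indicator (fun _ => (1 : ℝ)) ω - r := fun ω => by
      simp [g, Set.indicator_apply]
    rw [integral_complex_ofReal]
    simp_rw [e]
    rw [integral_sub ((integrable_const _).indicator hm) (integrable_const _),
      integral_indicator_const _ hm]
    simp [hr]
  -- Two-bin chaos, tested on the centred occupation indicator g at time t: the limit is the square
  -- of its mean, which is 0.
  have hcorr := h.tendsto_integral hX hη 2 (fun _ x => (g (x (Fin.last t)) : ℂ))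
    fun _ => ⟨1, fun x => by simpa using hg _⟩
  simp only [Fin.prod_univ_two, Fin.val_last, hzero, mul_zero, ← Complex.ofReal_mul,
    integral_complex_ofReal] at hcorr
  have hcorr' : Tendsto (fun m => ∫ ω, g (X (2 + m) t ω (Fin.castAdd m 0)) *
      g (X (2 + m) t ω (Fin.castAdd m 1)) ∂(P (2 + m))) atTop (𝓝 0) := by
    have := (Complex.continuous_re.tendsto _).comp hcorr
    simpa [Function.comp_def] using this
  refine tendsto_of_tendsto_add_left 2 ?_
  have hlim : Tendsto (fun m : ℕ => √(1 / ((2 + m : ℕ) : ℝ) +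
      |∫ ω, g (X (2 + m) t ω (Fin.castAdd m 0)) * g (X (2 + m) t ω (Fin.castAdd m 1))
        ∂(P (2 + m))|)) atTop (𝓝 0) := by
    have h1 : Tendsto (fun m : ℕ => 1 / ((2 + m : ℕ) : ℝ)) atTop (𝓝 0) := by
      have := (tendsto_add_atTop_iff_nat 2).2 (tendsto_one_div_atTop_nhds_zero_nat (𝕜 := ℝ))
      simpa [add_comm] using this
    have := (Real.continuous_sqrt.tendsto _).comp (h1.add hcorr'.abs)
    simpa [Function.comp_def] using this
  refine squeeze_zero (fun m => integral_nonneg fun ω => abs_nonneg _) (fun m => ?_) hlim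
  have hL : (0 : ℝ) < ((2 + m : ℕ) : ℝ) := by positivity
  have e : ∀ ω, (numOccupied (X (2 + m) t ω) : ℝ) / (2 + m : ℕ) - r =
      (∑ i, g (X (2 + m) t ω i)) / (2 + m : ℕ) := by
    intro ω
    rw [Finset.sum_sub_distrib, Finset.sum_const, Finset.card_univ, Fintype.card_fin, nsmul_eq_mul,
      sub_div, mul_div_cancel_left₀ _ hL.ne']
    simp [numOccupied, occupied]
  have hbd : ∀ ω, |(numOccupied (X (2 + m) t ω) : ℝ) / (2 + m : ℕ) - r| ≤ 1 := by
    intro ω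
    rw [e, abs_div, abs_of_pos hL, div_le_one hL]
    refine (Finset.abs_sum_le_sum_abs _ _).trans ?_
    refine (Finset.sum_le_sum fun i _ => hg _).trans ?_
    simp
  have hmeas : Measurable fun ω => (numOccupied (X (2 + m) t ω) : ℝ) / (2 + m : ℕ) - r :=
    (measurable_of_countable fun y : Fin (2 + m) → ℕ =>
      (numOccupied y : ℝ) / (2 + m : ℕ) - r).comp (hX _ t)
  refine (integral_abs_le_sqrt hmeas hbd).trans (Real.sqrt_le_sqrt ?_)
  simp_rw [e]
  refine (hexch (2 + m)).integral_mean_sq_le (hX _ t) hg ?_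
  intro h01
  simpa using congrArg Fin.val h01

/-- Prescribing the new contents of the first n bins amounts to prescribing the numbers b k of balls
they receive. -/
lemma stepMeasure_real_marginal {n m : ℕ} (ζ : Fin (n + m) → ℕ) (y b : Fin n → ℕ)
    (hy : ∀ k, y k = ζ (Fin.castAdd m k) - occupied ζ (Fin.castAdd m k) + b k) :
    (stepMeasure ζ).real {ζ' | ∀ k, ζ' (Fin.castAdd m k) = y k} =
      (numOccupied ζ).descFactorial (∑ k, b k) * (m : ℝ) ^ (numOccupied ζ - ∑ k, b k) /
        (∏ k, ((b k).factorial : ℝ)) / ((n + m : ℕ) : ℝ) ^ numOccupied ζ := by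
  classical
  rw [stepMeasure_real, ← sum_multinomial_marginal]
  congr 1
  refine Finset.sum_congr rfl fun σ _ => ?_
  simp only [Set.mem_ofPred_eq, Pi.add_apply, Pi.sub_apply, hy, Nat.add_left_cancel_iff]

/-- One step of the process, seen from the first `n` bins. -/
lemma IsRBBProcess.abs_real_succ_sub_le {Ω : Type*} [MeasurableSpace Ω] {P : Measure Ω}
    [IsProbabilityMeasure P] {n m : ℕ} {X : ℕ → Ω → Fin (n + m) → ℕ} (hX : IsRBBProcess X P)
    (hL : 0 < n + m) (t : ℕ) (ξ : Fin n → ℕ → ℕ) (b : Fin n → ℕ)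
    (hb : ∀ k, ξ k (t + 1) = ξ k t - (if 0 < ξ k t then 1 else 0) + b k)
    {r : ℝ} (hr0 : 0 ≤ r) (hr1 : r ≤ 1) :
    |P.real {ω | ∀ k, ∀ s ≤ t + 1, X s ω (Fin.castAdd m k) = ξ k s} -
        P.real {ω | ∀ k, ∀ s ≤ t, X s ω (Fin.castAdd m k) = ξ k s} *
          ∏ k, (Real.exp (-r) * r ^ b k / (b k).factorial)| ≤
      ((∑ k, b k : ℕ) ^ 2 + (∑ k, b k : ℕ) * n + n ^ 2) / (n + m : ℕ) +
        ((∑ k, b k : ℕ) + n) * ∫ ω, |(numOccupied (X t ω) : ℝ) / (n + m : ℕ) - r| ∂P := by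
  set c := ∏ k, (Real.exp (-r) * r ^ b k / (b k).factorial)
  set C := (((∑ k, b k : ℕ) : ℝ) ^ 2 + (∑ k, b k : ℕ) * n + n ^ 2) / (n + m : ℕ)
  set K := ((∑ k, b k : ℕ) : ℝ) + n
  let A : Set (Fin (t + 1) → Fin (n + m) → ℕ) := {x | ∀ k s, x s (Fin.castAdd m k) = ξ k s}
  let D : Set (Fin (n + m) → ℕ) := {ζ | ∀ k, ζ (Fin.castAdd m k) = ξ k (t + 1)}
  have hA : {ω | ∀ k, ∀ s ≤ t, X s ω (Fin.castAdd m k) = ξ k s} = hist X t ⁻¹' A := by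
    ext ω
    exact forall_congr' fun k => ⟨fun h s => h s (by omega), fun h s hs => h ⟨s, by omega⟩⟩
  have hAD : {ω | ∀ k, ∀ s ≤ t + 1, X s ω (Fin.castAdd m k) = ξ k s} =
      hist X t ⁻¹' A ∩ X (t + 1) ⁻¹' D := by
    rw [← hA]
    ext ω
    constructor
    · exact fun h => ⟨fun k s hs => h k s (by omega), fun k => h k (t + 1) le_rfl⟩
    · rintro ⟨h1, h2⟩ k s hs
      rcases Nat.lt_or_eq_of_le hs with hs | rfl
      · exact h1 k s (by omega)
      · exact h2 k
  have hmA : MeasurableSet (hist X t ⁻¹' A) :=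
    measurable_hist hX.measurable t (Set.to_countable A).measurableSet
  have hF : ∀ F : (Fin (n + m) → ℕ) → ℝ, (∃ B, ∀ y, |F y| ≤ B) →
      Integrable (fun ω => F (X t ω)) P := by
    rintro F ⟨B, hB⟩
    exact Integrable.of_bound ((measurable_of_countable F).comp
      (hX.measurable t)).aestronglyMeasurable B (Eventually.of_forall fun ω => hB _)
  have hlL : (0 : ℝ) < (n + m : ℕ) := by exact_mod_cast hL
  have hbd : ∀ y : Fin (n + m) → ℕ, |(numOccupied y : ℝ) / (n + m : ℕ) - r| ≤ 1 := by
    intro y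
    have h1 : (numOccupied y : ℝ) / (n + m : ℕ) ≤ 1 := by
      rw [div_le_one hlL]; exact_mod_cast numOccupied_le y
    have h2 : 0 ≤ (numOccupied y : ℝ) / (n + m : ℕ) := by positivity
    rw [abs_le]
    constructor <;> linarith
  have hint1 : Integrable (fun ω => (stepMeasure (X t ω)).real D) P :=
    hF (fun y => (stepMeasure y).real D) ⟨1, fun y => by
      rw [abs_of_nonneg measureReal_nonneg]; exact stepMeasure_real_le_one _ _⟩
  have hint2 : Integrable (fun ω => |(numOccupied (X t ω) : ℝ) / (n + m : ℕ) - r|) P :=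
    hF (fun y => |(numOccupied y : ℝ) / (n + m : ℕ) - r|) ⟨1, fun y => by simpa using hbd y⟩
  -- On the past event the contents of the first n bins are known, so the chance of the required
  -- step depends on ω only through the number of non-empty bins.
  have hpt : ∀ ω ∈ hist X t ⁻¹' A, |(stepMeasure (X t ω)).real D - c| ≤
      C + K * |(numOccupied (X t ω) : ℝ) / (n + m : ℕ) - r| := by
    intro ω hω
    have hξ : ∀ k, X t ω (Fin.castAdd m k) = ξ k t := fun k => hω k (Fin.last t)
    rw [stepMeasure_real_marginal (X t ω) (fun k => ξ k (t + 1)) b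
      (fun k => by rw [hb k, occupied, hξ k])]
    exact abs_marginal_sub_poisson_le b (numOccupied_le _) hL hr0 hr1
  have hK : 0 ≤ K := by positivity
  have hint3 : Integrable (fun ω => C + K * |(numOccupied (X t ω) : ℝ) / (n + m : ℕ) - r|) P :=
    (integrable_const _).add (hint2.const_mul _)
  have e : P.real (hist X t ⁻¹' A) * c = ∫ ω in hist X t ⁻¹' A, c ∂P := by
    rw [setIntegral_const, smul_eq_mul]
  rw [hAD, hA, hX.real_inter, e,
    ← integral_sub hint1.integrableOn (integrable_const _)]
  calc _ ≤ ∫ ω in hist X t ⁻¹' A, |(stepMeasure (X t ω)).real D - c| ∂P :=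
        abs_integral_le_integral_abs
    _ ≤ ∫ ω in hist X t ⁻¹' A, (C + K * |(numOccupied (X t ω) : ℝ) / (n + m : ℕ) - r|) ∂P :=
        setIntegral_mono_on (hint1.sub (integrable_const _)).abs.integrableOn
          hint3.integrableOn hmA hpt
    -- The error bound is nonnegative, so its integral may be extended from the past event to the
    -- whole space.
    _ ≤ ∫ ω, (C + K * |(numOccupied (X t ω) : ℝ) / (n + m : ℕ) - r|) ∂P :=
        setIntegral_le_integral hint3 (Eventually.of_forall fun ω => by positivity)
    _ = _ := by
      rw [integral_add (integrable_const _) (hint2.const_mul _), integral_const_mul]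
      simp

lemma IsRBBProcess.real_succ_eq_zero {Ω : Type*} [MeasurableSpace Ω] {P : Measure Ω}
    [IsFiniteMeasure P] {L : ℕ} {X : ℕ → Ω → Fin L → ℕ} (hX : IsRBBProcess X P)
    (t : ℕ) (i : Fin L) {x y : ℕ} (hxy : y < x - (if 0 < x then 1 else 0)) :
    P.real {ω | X t ω i = x ∧ X (t + 1) ω i = y} = 0 := by
  classical
  let A : Set (Fin (t + 1) → Fin L → ℕ) := {z | z (Fin.last t) i = x}
  have e : {ω | X t ω i = x ∧ X (t + 1) ω i = y} =
      hist X t ⁻¹' A ∩ X (t + 1) ⁻¹' {ζ | ζ i = y} := rfl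
  have hmA : MeasurableSet (hist X t ⁻¹' A) :=
    measurable_hist hX.measurable t (Set.to_countable A).measurableSet
  rw [e, hX.real_inter]
  refine (setIntegral_congr_fun hmA (g := fun _ => 0) fun ω hω => ?_).trans (by simp)
  have hx : X t ω i = x := hω
  simp only
  rw [stepMeasure_real, Finset.sum_eq_zero, zero_div]
  intro σ _
  refine if_neg fun h => ?_
  have h' : X t ω i - occupied (X t ω) i + σ i = y := h
  rw [occupied, hx] at h'
  omega

/-- The one-step estimate with r = ρ(t) has an error that vanishes by the law of large numbers; the
surviving Poisson factors are those of the nonlinear process. -/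
lemma ChaoticUpTo.succ [IsProbabilityMeasure Q] {μ : Measure ℕ} {t : ℕ}
    (h : ChaoticUpTo P X Q η t) (hX : ∀ L, IsRBBProcess (X L) (P L))
    (hη : IsNonlinearProcess η μ Q) (hexch : ∀ L, FinitelyExchangeable (X L t) (P L)) :
    ChaoticUpTo P X Q η (t + 1) := by
  intro n ξ
  by_cases hξ : ∀ k, ξ k t - (if 0 < ξ k t then 1 else 0) ≤ ξ k (t + 1)
  · choose b hb using fun k => Nat.exists_eq_add_of_le (hξ k)
    have hocc := h.tendsto_numOccupied (fun L => (hX L).measurable) hη.measurable hexch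
    set r := Q.real {ω | 0 < η t ω} with hr
    have hlim := (h n ξ).mul_const (∏ k, (Real.exp (-r) * r ^ b k / (b k).factorial))
    rw [← Finset.prod_mul_distrib, ← Finset.prod_congr rfl
      fun k _ => hη.real_succ t (ξ k) (b k) (hb k)] at hlim
    have hshift : Tendsto (fun m => n + m) atTop atTop := (tendsto_add_atTop_nat n).congr fun m => add_comm m n
    have hbound := (((tendsto_const_div_atTop_nhds_zero_nat
      (((∑ k, b k : ℕ) : ℝ) ^ 2 + (∑ k, b k : ℕ) * n + n ^ 2)).add
        (hocc.const_mul (((∑ k, b k : ℕ) : ℝ) + n)))).comp hshift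
    rw [mul_zero, add_zero] at hbound
    have hdiff := squeeze_zero_norm' (a := _) (f := fun m => (P (n + m)).real
        {ω | ∀ k, ∀ s ≤ t + 1, X (n + m) s ω (Fin.castAdd m k) = ξ k s} -
      (P (n + m)).real {ω | ∀ k, ∀ s ≤ t, X (n + m) s ω (Fin.castAdd m k) = ξ k s} *
        ∏ k, (Real.exp (-r) * r ^ b k / (b k).factorial))
      -- Taking m > 0 ensures n + m > 0 when n = 0.
      ((eventually_gt_atTop 0).mono fun m hm => (hX (n + m)).abs_real_succ_sub_le
        (by omega) t ξ b hb measureReal_nonneg measureReal_le_one) hbound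
    simpa using hdiff.add hlim
  -- Some prescribed path loses more than one ball in a step, which has probability zero for both
  -- processes.
  · push Not at hξ
    obtain ⟨k, hk⟩ := hξ
    rw [Finset.prod_eq_zero (Finset.mem_univ k) (hη.real_succ_eq_zero t (ξ k) hk)]
    refine tendsto_const_nhds.congr fun m => ?_
    refine (le_antisymm ?_ measureReal_nonneg).symm
    rw [← (hX (n + m)).real_succ_eq_zero t (Fin.castAdd m k) hk]
    exact measureReal_mono fun ω hω => ⟨hω k t (by omega), hω k (t + 1) le_rfl⟩

end Chaos

end RBB

theorem mainTheorem1
    {Ω : ℕ → Type*} [∀ L, MeasurableSpace (Ω L)]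
    (P : ∀ L, Measure (Ω L)) [∀ L, IsProbabilityMeasure (P L)]
    (X : ∀ L, ℕ → Ω L → Fin L → ℕ) (hX : ∀ L, RBB.IsRBBProcess (X L) (P L))
    (hexch : ∀ L, RBB.FinitelyExchangeable (X L 0) (P L))
    (μ : Measure ℕ) [IsProbabilityMeasure μ]
    -- the number of bins is `L = n + m`, and `m` tends to infinity
    (hchaos : ∀ (n : ℕ) (ξ : Fin n → ℕ),
      Tendsto (fun m : ℕ =>
          (P (n + m)).real {ω | ∀ k : Fin n, X (n + m) 0 ω (Fin.castAdd m k) = ξ k})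
        atTop (𝓝 (∏ k, μ.real {ξ k}))) :
    (∀ L t, RBB.FinitelyExchangeable (X L t) (P L)) ∧
    (∀ L, RBB.FinitelyExchangeable (fun ω (i : Fin L) (t : ℕ) => X L t ω i) (P L)) ∧
    ∀ {Ω' : Type*} [MeasurableSpace Ω'] (Q : Measure Ω') [IsProbabilityMeasure Q]
      (η : ℕ → Ω' → ℕ), RBB.IsNonlinearProcess η μ Q →
      ∀ (T n : ℕ) (Φ : Fin n → (Fin (T + 1) → ℕ) → ℂ),
        (∀ k, ∃ C : ℝ, ∀ x, ‖Φ k x‖ ≤ C) →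
        Tendsto (fun m : ℕ =>
            ∫ ω, ∏ k : Fin n,
              Φ k (fun s : Fin (T + 1) => X (n + m) s ω (Fin.castAdd m k)) ∂(P (n + m)))
          atTop (𝓝 (∏ k, ∫ ω, Φ k (fun s : Fin (T + 1) => η s ω) ∂Q)) := by
  have hexch' : ∀ L t, RBB.FinitelyExchangeable (X L t) (P L) :=
    fun L t => (hX L).exchangeable (hexch L) t
  refine ⟨hexch', fun L => (hX L).exchangeable_trajectory (hexch L), ?_⟩
  intro Ω' _ Q _ η hη T n Φ hΦ
  have hchaotic : ∀ t, RBB.ChaoticUpTo P X Q η t := by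
    intro t
    induction t with
    | zero =>
      intro n ξ
      have hQ : ∀ k, Q.real {ω | η 0 ω = ξ k 0} = μ.real {ξ k 0} := by
        intro k
        rw [← hη.initial, map_measureReal_apply (hη.measurable 0) (measurableSet_singleton _)]
        rfl
      simpa [hQ] using hchaos n fun k => ξ k 0
    | succ t ih => exact ih.succ hX hη fun L => hexch' L t
  exact (hchaotic T).tendsto_integral (fun L => (hX L).measurable) hη.measurable n Φ hΦ
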